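/- Let $n\ge 2$ and let $\mathcal G[k]=(\{v_1,\dots,v_n\},\mathcal E[k])$, $k=0,1,2,\dots$, be undirected simple graphs, with neighbor sets $\mathcal N_j[k]$. Suppose there are a connected graph $\mathcal G$ on the same nodes, an $l\in\mathbb N$ and instants $0=t_0<t_1<t_2<\cdots$ with $t_{m+1}-t_m<l$ such that for every $m$ the union of $\mathcal G[t_m],\dots,\mathcal G[t_{m+1}-1]$ equals $\mathcal G$. Suppose the nodes have distinct IDs, and let node $v_j$ have a load $l_j$, an unavailable memory $\delta_j$ and a total memory $\nu_j^{\max}$; these are nonnegative integers with $l_j+\delta_j>0$, $\nu_j^{\max}>0$ and $\sum_j l_j\le\sum_j(\nu_j^{\max}-\delta_j)$. Put $$w_j^*=\frac{\sum_i l_i+\sum_i\delta_i}{\sum_i\nu_i^{\max}}\,\nu_j^{\max}-\delta_j .$$ Consider the following algorithm. Every node $v_j$ stores integers $y_j,z_j$ (its mass), $y_j^s,z_j^s$ (its state) and a set $S_j$ of IDs. Pairs $(y,z)$ are compared lexicographically, $z$ first. Initially $z_j=l_j+\delta_j$, $y_j=\nu_j^{\max}$, $z_j^s=1$, $y_j^s=y_j$,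 $v_j$ broadcasts its state to $\mathcal N_j[0]$ and $S_j=\mathcal N_j[0]$; these broadcasts are received in iteration $0$. A message sent in iteration $k$ is received by its addressee in iteration $k+1$. In iteration $k=0,1,2,\dots$ every node $v_j$ does the following. 1. It adds all masses it receives to its own mass. 2. If it received any message (a state, or a mass, possibly one sent by itself): (a) if some received state is greater than its own state, its state becomes the greatest received state; (b) if then its mass is greater than its state, its state becomes its mass; (c) if $0<z_j<z_j^s$, or $z_j=z_j^s$ and $y_j<y_j^s$, it decides to transmit its mass, unless $z_j>0$ and $y_j/z_j=y_j^s/z_j^s$; (d) if its state was changed in (a) or (b), it decides to broadcast its state and sets $S_j=\mathcal N_j[k]$. 3. If $\mathcal N_j[k]\not\subseteq S_j$, it decides to broadcast its state and replaces $S_j$ by $S_j\cup\mathcal N_j[k]$. 4. If it decided to transmit its mass, it sends its mass to one node $v_i$ chosen uniformly at random from $\mathcal N_j[k]\cup\{v_j\}$ and sets $y_j=z_j=0$. If it decided to broadcast, it sends its state to all nodes of $\mathcal N_j[k]$. The random choices of different nodes and iterations are independent. The computation of a node in an iteration uses only its own variables, the messages it receives and the IDs of its current neighbors, and no global parameter of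 the network such as its diameter. The allocation that $v_j$ computes is $\nu_j^{\max}/q_j^s[k]-\delta_j$, where $q_j^s[k]=y_j^s/z_j^s$ is the quotient of the two integers of its state at the beginning of iteration $k$. Then for every $p_0'\in(0,1)$ there is a finite $k_0'$ such that, with probability at least $p_0'$, for every node $v_j$ and every $k\ge k_0'$: (i) the allocation that $v_j$ computes is exactly the optimal one, $\nu_j^{\max}/q_j^s[k]-\delta_j=w_j^*$, and (ii) $v_j$ transmits nothing in iteration $k$, neither its mass nor its state. -/

import Mathlib

open MeasureTheory
open scoped BigOperators ENNReal

noncomputable section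

namespace DataAlloc

/-- The set `𝒩_j[k]` of current neighbours of node `j` in the graph `G = 𝒢[k]`. -/
def nbrs {n : ℕ} (G : SimpleGraph (Fin n)) (j : Fin n) : Finset (Fin n) :=
  open Classical in Finset.univ.filter (fun i => G.Adj j i)

/-- The union graph of `𝒢[a], …, 𝒢[b-1]`. -/
def unionGraph {n : ℕ} (G : ℕ → SimpleGraph (Fin n)) (a b : ℕ) : SimpleGraph (Fin n) :=
  ⨆ k ∈ Set.Ico a b, G k

/-- The dynamic graph `G` has window length `l` and nominal graph `Gnom`: there are instants
`0 = t 0 < t 1 < …` with gaps less than `l`, the union of the graphs over each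
`[t m, t (m+1))` is `Gnom`, and `Gnom` is connected. -/
def HasNominalGraph {n : ℕ} (G : ℕ → SimpleGraph (Fin n)) (Gnom : SimpleGraph (Fin n))
    (l : ℕ) : Prop :=
  Gnom.Connected ∧
    ∃ t : ℕ → ℕ, t 0 = 0 ∧
      ∀ m, t m < t (m + 1) ∧ t (m + 1) - t m < l ∧ unionGraph G (t m) (t (m + 1)) = Gnom

/-! ### The random choices -/

/-- The probability `b_{lj}[k]` with which node `j` addresses node `l`
(`l = j` is the virtual self-edge). -/
def edgeProb {n : ℕ} (G : SimpleGraph (Fin n)) (l j : Fin n) : ℝ≥0∞ :=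
  open Classical in if l = j ∨ l ∈ nbrs G j then (((nbrs G j).card : ℝ≥0∞) + 1)⁻¹ else 0

theorem sum_edgeProb {n : ℕ} (G : SimpleGraph (Fin n)) (j : Fin n) :
    ∑ l, edgeProb G l j = 1 := by
  classical
  have hj : j ∉ nbrs G j := by simp [nbrs]
  have hfilter : (Finset.univ.filter fun l => l = j ∨ l ∈ nbrs G j) = insert j (nbrs G j) := by
    ext l; simp
  have h : ∑ l, edgeProb G l j
      = ∑ l ∈ insert j (nbrs G j), (((nbrs G j).card : ℝ≥0∞) + 1)⁻¹ := by
    rw [← hfilter, Finset.sum_filter]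
    refine Finset.sum_congr rfl fun l _ => ?_
    simp [edgeProb]
  rw [h, Finset.sum_const, Finset.card_insert_of_notMem hj, nsmul_eq_mul]
  push_cast
  exact ENNReal.mul_inv_cancel (by simp) (by finiteness)

/-- The law of the node addressed by node `j` when the current graph is `G`. -/
def choiceLaw {n : ℕ} (G : SimpleGraph (Fin n)) (j : Fin n) : PMF (Fin n) :=
  PMF.ofFintype (fun l => edgeProb G l j) (sum_edgeProb G j)

/-- A realization of the random choices: `ω (k, j)` is the node that node `j` addresses in
iteration `k`, if it transmits its mass variables in that iteration. -/
abbrev Choices (n : ℕ) : Type := ℕ × Fin n → Fin n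

/-- The choices of different nodes and of different iterations are independent, and the one of
node `j` in iteration `k` has law `b_{·j}[k]`. -/
def choiceMeasure {n : ℕ} (G : ℕ → SimpleGraph (Fin n)) : Measure (Choices n) :=
  Measure.infinitePi fun p : ℕ × Fin n => (choiceLaw (G p.1) p.2).toMeasure

/-! ### The algorithm -/

/-- What a node stores: its mass variables `y, z`, its state variables `ys, zs` (standing for
`y^s, z^s`) and the set `S` of IDs of nodes that were sent the current state variables. -/
structure NodeState (ID : Type*) where
  y : ℤ
  z : ℕ
  ys : ℤ
  zs : ℕ
  S : Finset ID

/-- The state fraction `q^s = y^s / z^s`. -/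
def NodeState.qs {ID : Type*} (s : NodeState ID) : ℚ := (s.ys : ℚ) / (s.zs : ℚ)

/-- The messages that a node receives in one iteration, by sender: state variables `(y^s, z^s)`
and mass variables `(y, z)`; `none` means that there is no such message from that sender. -/
structure Inbox (n : ℕ) where
  stateMsg : Fin n → Option (ℤ × ℕ)
  massMsg : Fin n → Option (ℤ × ℕ)

/-- Some message was received. -/
def Inbox.Received {n : ℕ} (b : Inbox n) : Prop :=
  (∃ i, (b.massMsg i).isSome) ∨ (∃ i, (b.stateMsg i).isSome)

/-- A pair `(y, z)` of variables as an element of the lexicographic order in which `z` is compared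
first; this is the order in which pairs of mass or state variables are "greater". -/
def key (p : ℤ × ℕ) : ℕ ×ₗ ℤ := toLex (p.2, p.1)

/-- The greatest pair among the node's own pair `p` and the received state variables. -/
def maxReceived {n : ℕ} (b : Inbox n) (p : ℤ × ℕ) : ℕ ×ₗ ℤ :=
  (Finset.univ : Finset (Option (Fin n))).sup' ⟨none, Finset.mem_univ _⟩
    (fun o => key (match o with
      | none => p
      | some i => (b.stateMsg i).getD p))

/-- The values in a node just before it transmits: the updated variables and the two flags
`Mtr` (transmit the mass variables) and `Sbr` (broadcast the state variables). -/
structure Decision (ID : Type*) where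
  y : ℤ
  z : ℕ
  ys : ℤ
  zs : ℕ
  S : Finset ID
  Mtr : Prop
  Sbr : Prop

/-- The event-triggered updates, executed by a node that received some message. Here `y, z` are the
mass variables after the received ones were added, and `N` is the set of the IDs of the current
neighbours. -/
def eventTrigger {n : ℕ} {ID : Type*} (N : Finset ID) (b : Inbox n) (s : NodeState ID)
    (y : ℤ) (z : ℕ) : Decision ID :=
  open Classical in
  let own : ℕ ×ₗ ℤ := key (s.ys, s.zs)
  -- condition 1: adopt the greatest received state variables if they exceed one's own
  let st1 : ℕ ×ₗ ℤ := maxReceived b (s.ys, s.zs)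
  let br1 : Prop := own < st1
  -- condition 2: adopt one's own mass variables if they exceed the state variables
  let br2 : Prop := st1 < key (y, z)
  let st2 : ℕ ×ₗ ℤ := if br2 then key (y, z) else st1
  let zs : ℕ := (ofLex st2).1
  let ys : ℤ := (ofLex st2).2
  -- condition 3: the mass variables are nonzero and smaller than the state variables
  let smaller : Prop := (0 < z ∧ z < zs) ∨ (z = zs ∧ y < ys)
  -- condition 4: the mass fraction equals the state fraction
  let sameFraction : Prop := 0 < z ∧ (y : ℚ) / (z : ℚ) = (ys : ℚ) / (zs : ℚ)
  let br : Prop := br1 ∨ br2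
  { y := y
    z := z
    ys := ys
    zs := zs
    -- condition 5: a node that broadcasts new state variables restarts the set `S`
    S := if br then N else s.S
    Mtr := smaller ∧ ¬ sameFraction
    Sbr := br }

/-- The computation of one node in one iteration. It uses only the IDs `N` of the current
neighbours, the received messages and the node's own variables. -/
def localStep {n : ℕ} {ID : Type*} (N : Finset ID) (b : Inbox n) (s : NodeState ID) :
    Decision ID :=
  open Classical in
  let y : ℤ := s.y + ∑ i, ((b.massMsg i).getD (0, 0)).1
  let z : ℕ := s.z + ∑ i, ((b.massMsg i).getD (0, 0)).2
  let d : Decision ID :=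
    if b.Received then eventTrigger N b s y z
    else { y := y, z := z, ys := s.ys, zs := s.zs, S := s.S, Mtr := False, Sbr := False }
  -- a current neighbour that was not sent the current state variables triggers a broadcast
  { d with
    S := d.S ∪ N
    Sbr := d.Sbr ∨ ¬ N ⊆ d.S }

/-- The network at the beginning of an iteration: the variables of every node and the messages
that were sent to it and that it receives in this iteration. -/
structure Config (n : ℕ) (ID : Type*) where
  node : Fin n → NodeState ID
  inbox : Fin n → Inbox n

/-- The IDs of the current neighbours of node `j`. -/
def nbrIds {n : ℕ} {ID : Type*} (ids : Fin n → ID) (G : SimpleGraph (Fin n)) (j : Fin n) :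
    Finset ID :=
  open Classical in (nbrs G j).image ids

/-- Initialization, with loads `L j`, unavailable memories `δ j` and total memories `ν j`:
`z_j = L_j + δ_j`, `y_j = ν_j`, `z^s_j = 1`, `y^s_j = y_j`; every node broadcasts its state
variables to its neighbours in `𝒢[0]` and stores their IDs. -/
def initConfig {n : ℕ} {ID : Type*} (ids : Fin n → ID) (G0 : SimpleGraph (Fin n))
    (L δ ν : Fin n → ℕ) : Config n ID where
  node j :=
    { y := (ν j : ℤ)
      z := L j + δ j
      ys := (ν j : ℤ)
      zs := 1
      S := nbrIds ids G0 j }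
  inbox j :=
    { stateMsg := fun i => open Classical in
        if i ∈ nbrs G0 j then some ((ν i : ℤ), 1) else none
      massMsg := fun _ => none }

/-- What node `j` decides in an iteration with graph `G` that begins in configuration `c`. -/
def nodeDecision {n : ℕ} {ID : Type*} (ids : Fin n → ID) (G : SimpleGraph (Fin n))
    (c : Config n ID) (j : Fin n) : Decision ID :=
  localStep (nbrIds ids G j) (c.inbox j) (c.node j)

/-- One iteration with graph `G`, where `r i` is the node that `i` addresses if it transmits its
mass variables. A message over an edge of `G` (or over the virtual self-edge) is received by its
addressee in the next iteration; transmitted mass variables are set to zero at the sender. -/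
def step {n : ℕ} {ID : Type*} (ids : Fin n → ID) (G : SimpleGraph (Fin n)) (r : Fin n → Fin n)
    (c : Config n ID) : Config n ID where
  node j :=
    open Classical in
    let d := nodeDecision ids G c j
    { y := if d.Mtr then 0 else d.y
      z := if d.Mtr then 0 else d.z
      ys := d.ys
      zs := d.zs
      S := d.S }
  inbox j :=
    { stateMsg := fun i => open Classical in
        let d := nodeDecision ids G c i
        if d.Sbr ∧ i ∈ nbrs G j then some (d.ys, d.zs) else none
      massMsg := fun i => open Classical in
        let d := nodeDecision ids G c i
        if d.Mtr ∧ r i = j then some (d.y, d.z) else none }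

/-- The configuration at the beginning of iteration `k`. -/
def run {n : ℕ} {ID : Type*} (ids : Fin n → ID) (G : ℕ → SimpleGraph (Fin n))
    (L δ ν : Fin n → ℕ) (ω : Choices n) : ℕ → Config n ID
  | 0 => initConfig ids (G 0) L δ ν
  | k + 1 => step ids (G k) (fun j => ω (k, j)) (run ids G L δ ν ω k)

/-- Node `j` transmits (its mass variables or its state variables) in iteration `k`. -/
def Transmits {n : ℕ} {ID : Type*} (ids : Fin n → ID) (G : ℕ → SimpleGraph (Fin n))
    (L δ ν : Fin n → ℕ) (ω : Choices n) (k : ℕ) (j : Fin n) : Prop :=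
  (nodeDecision ids (G k) (run ids G L δ ν ω k) j).Mtr ∨
    (nodeDecision ids (G k) (run ids G L δ ν ω k) j).Sbr

/-- The allocation `ν_j / q^s_j[k] - δ_j` that node `j` computes from its state variables. -/
def output {n : ℕ} {ID : Type*} (ids : Fin n → ID) (G : ℕ → SimpleGraph (Fin n))
    (L δ ν : Fin n → ℕ) (ω : Choices n) (k : ℕ) (j : Fin n) : ℚ :=
  (ν j : ℚ) / ((run ids G L δ ν ω k).node j).qs - (δ j : ℚ)

/-- The optimal amount of data
`w*_j = (μ + δ_tot) / ν^max * ν_j - δ_j`, where `μ`, `δ_tot` and `ν^max` are the total load, the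
total unavailable memory and the total memory. -/
def optimalWorkload {n : ℕ} (L δ ν : Fin n → ℕ) (j : Fin n) : ℚ :=
  ((∑ i, (L i : ℚ)) + ∑ i, (δ i : ℚ)) / (∑ i, (ν i : ℚ)) * (ν j : ℚ) - (δ j : ℚ)

end DataAlloc

end

/-! Deterministic part. If the messages just arriving are counted with the stored mass, masses only
move and merge as wholes. So their sum is conserved, the greatest mass never decreases, and it
bounds every state (`Inv`). While every node addresses itself, the masses stand still and the
greatest one floods the connected graph `Gnom`, until all states equal it (`exists_synced`). From
then on a mass is transmitted exactly if its fraction differs from that of the greatest mass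
(`Synced.mtr_iff`). Such a mass can be routed towards the node with the greatest mass, and meets
another nonzero mass there at the latest (`exists_merge`). With at most `n` nonzero masses,
alternating flooding and merging ends with all masses proportional. The common state then has the
fraction of the total mass, which gives the optimal allocation. Once every set `S` contains all
neighbours in `Gnom`, nothing is sent any more (`Terminal`), and this persists under all choices.

Probabilistic part. The favourable schedule has a length `T` that depends neither on the starting
time nor on the configuration, and each of its `T * n` choices has probability at least `1 / n`.
Hence every block of `T` iterations shrinks the probability of not being terminal by the factor `1 -
n⁻¹ ^ (T * n)` (`exists_contraction`), and this probability tends to zero. -/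

namespace DataAlloc

/-! ### The order on pairs -/

theorem key_injective : Function.Injective key := by
  rintro ⟨a, b⟩ ⟨c, d⟩ h
  have := toLex.injective h
  simp only [Prod.mk.injEq] at this ⊢
  exact ⟨this.2, this.1⟩

theorem key_le_key {a b : ℤ × ℕ} : key a ≤ key b ↔ a.2 < b.2 ∨ a.2 = b.2 ∧ a.1 ≤ b.1 := by
  simp [key, Prod.Lex.toLex_le_toLex]

theorem snd_le_of_key_le {a b : ℤ × ℕ} (h : key a ≤ key b) : a.2 ≤ b.2 := by
  rcases key_le_key.1 h with h | h
  · exact h.le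
  · exact h.1.le

theorem key_ofLex (x : ℕ ×ₗ ℤ) : key ((ofLex x).2, (ofLex x).1) = x := rfl

/-- A pair of mass variables that is zero or has two positive entries. -/
def IsMass (a : ℤ × ℕ) : Prop := a = 0 ∨ 0 < a.1 ∧ 0 < a.2

theorem IsMass.add {a b : ℤ × ℕ} (ha : IsMass a) (hb : IsMass b) : IsMass (a + b) := by
  rcases ha with rfl | ha
  · simpa using hb
  rcases hb with rfl | hb
  · rw [add_zero]
    exact Or.inr ha
  exact Or.inr ⟨add_pos ha.1 hb.1, add_pos ha.2 hb.2⟩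

theorem IsMass.sum {ι : Type*} {s : Finset ι} {f : ι → ℤ × ℕ} (h : ∀ i ∈ s, IsMass (f i)) :
    IsMass (∑ i ∈ s, f i) :=
  Finset.sum_induction f IsMass (fun _ _ => IsMass.add) (Or.inl rfl) h

theorem IsMass.nonneg {a : ℤ × ℕ} (ha : IsMass a) : 0 ≤ a := by
  rcases ha with rfl | ha
  · exact le_rfl
  · exact ⟨ha.1.le, ha.2.le⟩

theorem key_mono {a b : ℤ × ℕ} (h : a ≤ b) : key a ≤ key b := by
  rw [key_le_key]
  rcases h.2.lt_or_eq with h2 | h2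
  · exact Or.inl h2
  · exact Or.inr ⟨h2, h.1⟩

/-- The fractions `a.1 / a.2` and `b.1 / b.2` agree, in cross-multiplied form. -/
def Proportional (a b : ℤ × ℕ) : Prop := a.1 * b.2 = b.1 * a.2

/-- The condition under which the mass `m` is transmitted by a node in state `s`. -/
def Lagging (m s : ℤ × ℕ) : Prop :=
  ((0 < m.2 ∧ m.2 < s.2) ∨ (m.2 = s.2 ∧ m.1 < s.1)) ∧
    ¬ (0 < m.2 ∧ (m.1 : ℚ) / (m.2 : ℚ) = (s.1 : ℚ) / (s.2 : ℚ))

/-- Given the order, equal second entries without a strict inequality between the first ones force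
equal pairs. The zero mass is proportional to everything and is never transmitted, since `b.2` is
positive. -/
theorem lagging_iff {a b : ℤ × ℕ} (ha : IsMass a) (hb : 0 < b.2) (hab : key a ≤ key b) :
    Lagging a b ↔ ¬ Proportional a b := by
  unfold Lagging Proportional
  rcases ha with rfl | ⟨_, ha⟩
  · simp [hb.ne]
  · have ha' : (a.2 : ℚ) ≠ 0 := by positivity
    have hb' : (b.2 : ℚ) ≠ 0 := by positivity
    have hfrac : (a.1 : ℚ) / (a.2 : ℚ) = (b.1 : ℚ) / (b.2 : ℚ) ↔ a.1 * b.2 = b.1 * a.2 := by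
      rw [div_eq_div_iff ha' hb']
      norm_cast
    simp only [hfrac, ha, true_and]
    refine ⟨fun h => h.2, fun h => ⟨?_, h⟩⟩
    rcases key_le_key.1 hab with h1 | ⟨h1, h2⟩
    · exact Or.inl h1
    · refine Or.inr ⟨h1, lt_of_le_of_ne h2 fun h3 => h ?_⟩
      rw [h1, h3]

/-! ### Configurations -/

section Config

variable {n : ℕ} {ID : Type*}

/-- The mass of node `j` after the masses that it receives are added. -/
def mass (c : Config n ID) (j : Fin n) : ℤ × ℕ :=
  ((c.node j).y, (c.node j).z) + ∑ i, ((c.inbox j).massMsg i).getD 0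

/-- The state variables of node `j`. -/
def statePair (c : Config n ID) (j : Fin n) : ℤ × ℕ := ((c.node j).ys, (c.node j).zs)

/-- The greatest of the own and the received state variables of node `j`. -/
def pendingKey (c : Config n ID) (j : Fin n) : ℕ ×ₗ ℤ := maxReceived (c.inbox j) (statePair c j)

/-- The stored mass of node `j` neither exceeds its state nor has to be transmitted. -/
def Settled (c : Config n ID) (j : Fin n) : Prop :=
  key ((c.node j).y, (c.node j).z) ≤ key (statePair c j) ∧
    ¬ Lagging ((c.node j).y, (c.node j).z) (statePair c j)

theorem key_le_maxReceived (b : Inbox n) (p : ℤ × ℕ) : key p ≤ maxReceived b p :=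
  Finset.le_sup' (f := fun o : Option (Fin n) => key (match o with
      | none => p
      | some i => (b.stateMsg i).getD p)) (Finset.mem_univ none)

theorem key_getD_le_maxReceived (b : Inbox n) (p : ℤ × ℕ) (i : Fin n) :
    key ((b.stateMsg i).getD p) ≤ maxReceived b p :=
  Finset.le_sup' (f := fun o : Option (Fin n) => key (match o with
      | none => p
      | some i => (b.stateMsg i).getD p)) (Finset.mem_univ (some i))

theorem maxReceived_le {b : Inbox n} {p : ℤ × ℕ} {B : ℕ ×ₗ ℤ} (hp : key p ≤ B)
    (h : ∀ i, key ((b.stateMsg i).getD p) ≤ B) : maxReceived b p ≤ B := by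
  refine Finset.sup'_le _ _ fun o _ => ?_
  cases o with
  | none => exact hp
  | some i => exact h i

theorem stateKey_le_pendingKey (c : Config n ID) (j : Fin n) :
    key (statePair c j) ≤ pendingKey c j := key_le_maxReceived _ _

theorem mass_of_not_received {c : Config n ID} {j : Fin n} (h : ¬ (c.inbox j).Received) :
    mass c j = ((c.node j).y, (c.node j).z) := by
  have h0 : ∀ i, (c.inbox j).massMsg i = none := fun i => by
    by_contra hi
    exact h (Or.inl ⟨i, Option.isSome_iff_ne_none.2 hi⟩)
  simp [mass, h0]

theorem pendingKey_of_not_received {c : Config n ID} {j : Fin n} (h : ¬ (c.inbox j).Received) :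
    pendingKey c j = key (statePair c j) := by
  have h0 : ∀ i, (c.inbox j).stateMsg i = none := fun i => by
    by_contra hi
    exact h (Or.inr ⟨i, Option.isSome_iff_ne_none.2 hi⟩)
  exact le_antisymm (maxReceived_le le_rfl fun i => by simp [h0]) (stateKey_le_pendingKey c j)

/-! ### The decision of a node -/

variable (ids : Fin n → ID) (G : SimpleGraph (Fin n)) (c : Config n ID) (j : Fin n)

/-- The state variables of node `j` after its computation. -/
noncomputable def newPair : ℤ × ℕ := ((nodeDecision ids G c j).ys, (nodeDecision ids G c j).zs)

theorem nodeDecision_mass :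
    ((nodeDecision ids G c j).y, (nodeDecision ids G c j).z) = mass c j := by
  unfold nodeDecision localStep mass
  split_ifs <;> simp [eventTrigger, Prod.ext_iff, Prod.fst_sum, Prod.snd_sum] <;> exact ⟨rfl, rfl⟩

theorem key_newPair_of_received (h : (c.inbox j).Received) :
    key (newPair ids G c j) = max (pendingKey c j) (key (mass c j)) := by
  have hm := nodeDecision_mass ids G c j
  revert hm
  unfold newPair nodeDecision localStep
  simp only [if_pos h, eventTrigger]
  intro hm
  rw [key_ofLex, hm]
  split_ifs with h1
  · exact (max_eq_right h1.le).symm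
  · exact (max_eq_left (not_lt.1 h1)).symm

theorem newPair_of_not_received (h : ¬ (c.inbox j).Received) :
    newPair ids G c j = statePair c j := by
  unfold newPair nodeDecision localStep
  simp only [if_neg h]
  rfl

theorem mtr_iff : (nodeDecision ids G c j).Mtr ↔
    (c.inbox j).Received ∧ Lagging (mass c j) (newPair ids G c j) := by
  have hm := nodeDecision_mass ids G c j
  rw [← hm]
  unfold newPair nodeDecision localStep
  by_cases h : (c.inbox j).Received
  · simp only [if_pos h]
    exact ⟨fun h1 => ⟨h, h1⟩, And.right⟩
  · simp only [if_neg h]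
    exact ⟨False.elim, fun h1 => h h1.1⟩

theorem pendingKey_le_newKey : pendingKey c j ≤ key (newPair ids G c j) := by
  by_cases h : (c.inbox j).Received
  · rw [key_newPair_of_received _ _ _ _ h]
    exact le_max_left _ _
  · rw [newPair_of_not_received _ _ _ _ h, pendingKey_of_not_received h]

theorem stateKey_le_newKey : key (statePair c j) ≤ key (newPair ids G c j) :=
  (stateKey_le_pendingKey c j).trans (pendingKey_le_newKey ids G c j)

-- Whether or not a message arrived, broadcasting and the update of `S` depend only on whether the
-- state changed and on the current neighbours.
open Classical in
theorem decision_S_sbr :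
    (nodeDecision ids G c j).S =
      (if statePair c j = newPair ids G c j then (c.node j).S ∪ nbrIds ids G j
        else nbrIds ids G j) ∧
    ((nodeDecision ids G c j).Sbr ↔
      statePair c j ≠ newPair ids G c j ∨ ¬ nbrIds ids G j ⊆ (c.node j).S) := by
  by_cases h : (c.inbox j).Received
  · have hbr : (key (statePair c j) < pendingKey c j ∨ pendingKey c j < key (mass c j)) ↔
        statePair c j ≠ newPair ids G c j := by
      rw [← key_injective.ne_iff, key_newPair_of_received _ _ _ _ h]
      have := stateKey_le_pendingKey c j
      constructor
      · rintro (h1 | h1)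
        · exact (h1.trans_le (le_max_left _ _)).ne
        · exact (this.trans_lt (h1.trans_le (le_max_right _ _))).ne
      · intro hne
        by_contra! hcon
        rw [max_eq_left hcon.2] at hne
        exact hne (le_antisymm this hcon.1)
    have hm := nodeDecision_mass ids G c j
    rw [← hm] at hbr
    have hS : (nodeDecision ids G c j).S = (if statePair c j ≠ newPair ids G c j
        then nbrIds ids G j else (c.node j).S) ∪ nbrIds ids G j := by
      simp only [← hbr]
      unfold nodeDecision localStep
      simp only [if_pos h, eventTrigger]
      congr 1
    have hB : (nodeDecision ids G c j).Sbr ↔ (statePair c j ≠ newPair ids G c j ∨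
        ¬ nbrIds ids G j ⊆ (if statePair c j ≠ newPair ids G c j
        then nbrIds ids G j else (c.node j).S)) := by
      simp only [← hbr]
      unfold nodeDecision localStep
      simp only [if_pos h, eventTrigger]
      rfl
    rw [hS, hB]
    by_cases he : statePair c j = newPair ids G c j <;> simp [he]
  · rw [newPair_of_not_received _ _ _ _ h]
    unfold nodeDecision localStep
    simp only [if_neg h]
    simp

variable {ids G c j}

/-- A node without messages skips the event-triggered updates. For a settled node they would have no
effect, so the case distinction on `Received` disappears. -/
theorem Settled.key_newPair (h : Settled c j) :
    key (newPair ids G c j) = max (pendingKey c j) (key (mass c j)) := by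
  by_cases hr : (c.inbox j).Received
  · exact key_newPair_of_received _ _ _ _ hr
  · rw [newPair_of_not_received _ _ _ _ hr, pendingKey_of_not_received hr,
      mass_of_not_received hr, max_eq_left h.1]

theorem Settled.mtr_iff (h : Settled c j) :
    (nodeDecision ids G c j).Mtr ↔ Lagging (mass c j) (newPair ids G c j) := by
  rw [DataAlloc.mtr_iff]
  refine ⟨fun h => h.2, fun h1 => ⟨?_, h1⟩⟩
  by_contra hr
  rw [newPair_of_not_received _ _ _ _ hr, mass_of_not_received hr] at h1
  exact h.2 h1

/-! ### One iteration -/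

variable (r : Fin n → Fin n)

theorem statePair_step : statePair (step ids G r c) j = newPair ids G c j := rfl

theorem S_step : ((step ids G r c).node j).S = (nodeDecision ids G c j).S := rfl

theorem stored_step : open Classical in (((step ids G r c).node j).y, ((step ids G r c).node j).z)
    = if (nodeDecision ids G c j).Mtr then 0 else mass c j := by
  rw [← nodeDecision_mass ids G c j]
  simp only [step]
  split_ifs <;> rfl

/-- The position of the mass of node `i` after an iteration. -/
noncomputable def dest (ids : Fin n → ID) (G : SimpleGraph (Fin n)) (c : Config n ID)
    (r : Fin n → Fin n) (i : Fin n) : Fin n :=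
  open Classical in if (nodeDecision ids G c i).Mtr then r i else i

/-- A transmitted mass leaves the store of the sender and is counted at the addressee at once, as
part of the next inbox. -/
theorem mass_step : mass (step ids G r c) j =
    ∑ i, if dest ids G c r i = j then mass c i else 0 := by
  classical
  have h1 : ∀ i, (((step ids G r c).inbox j).massMsg i).getD 0
      = if (nodeDecision ids G c i).Mtr ∧ r i = j then mass c i else 0 := by
    intro i
    rw [← nodeDecision_mass ids G c i]
    simp only [step]
    split_ifs <;> rfl
  rw [mass, stored_step]
  simp only [h1]
  have h2 : (if (nodeDecision ids G c j).Mtr then 0 else mass c j)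
      = ∑ i, if i = j then (if (nodeDecision ids G c i).Mtr then 0 else mass c i) else 0 := by
    simp
  rw [h2, ← Finset.sum_add_distrib]
  refine Finset.sum_congr rfl fun i _ => ?_
  by_cases hM : (nodeDecision ids G c i).Mtr <;> simp [dest, hM]

theorem settled_step (h : Settled c j ∨ (c.inbox j).Received)
    (hz : 0 < (statePair c j).2) : Settled (step ids G r c) j := by
  have hle : key (mass c j) ≤ key (newPair ids G c j) := by
    rcases h with h | h
    · rw [h.key_newPair]
      exact le_max_right _ _
    · rw [key_newPair_of_received _ _ _ _ h]
      exact le_max_right _ _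
  have hM : (nodeDecision ids G c j).Mtr ↔ Lagging (mass c j) (newPair ids G c j) := by
    rcases h with h | h
    · exact h.mtr_iff
    · rw [mtr_iff]
      exact and_iff_right h
  have hz' : 0 < (newPair ids G c j).2 :=
    hz.trans_le (snd_le_of_key_le (stateKey_le_newKey ids G c j))
  unfold Settled
  rw [stored_step, statePair_step]
  split_ifs with h1
  · refine ⟨?_, ?_⟩
    · exact key_le_key.2 (Or.inl hz')
    · rintro ⟨h2 | h2, -⟩
      · exact absurd h2.1 (lt_irrefl _)
      · exact hz'.ne h2.1
  · exact ⟨hle, fun h2 => h1 (hM.2 h2)⟩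

theorem stateMsg_step (i : Fin n) : open Classical in ((step ids G r c).inbox j).stateMsg i =
    if (nodeDecision ids G c i).Sbr ∧ G.Adj j i then some (newPair ids G c i) else none := by
  have h : i ∈ nbrs G j ↔ G.Adj j i := by simp [nbrs]
  by_cases h1 : (nodeDecision ids G c i).Sbr <;> by_cases h2 : G.Adj j i <;>
    simp [step, newPair, h, h1, h2]

theorem pendingKey_step_le {B : ℕ ×ₗ ℤ} (h : ∀ i, key (newPair ids G c i) ≤ B) :
    pendingKey (step ids G r c) j ≤ B := by
  refine maxReceived_le (h j) fun i => ?_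
  rw [stateMsg_step]
  split_ifs
  · exact h i
  · exact h j

theorem le_pendingKey_step {i : Fin n} (h : (nodeDecision ids G c i).Sbr) (hij : G.Adj j i) :
    key (newPair ids G c i) ≤ pendingKey (step ids G r c) j := by
  have := key_getD_le_maxReceived ((step ids G r c).inbox j) (statePair (step ids G r c) j) i
  rwa [stateMsg_step, if_pos ⟨h, hij⟩] at this

theorem received_step {i : Fin n} (h : (nodeDecision ids G c i).Sbr) (hij : G.Adj j i) :
    ((step ids G r c).inbox j).Received := by
  refine Or.inr ⟨i, ?_⟩
  rw [stateMsg_step, if_pos ⟨h, hij⟩]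
  rfl

theorem mem_nbrIds (hids : Function.Injective ids) {i : Fin n} :
    ids i ∈ nbrIds ids G j ↔ G.Adj j i := by
  simp [nbrIds, nbrs, hids.eq_iff]

/-- A node either broadcasts its new state variables to the node `i`, or they are the old ones
and were sent to `i` before. -/
theorem sent_of_mem_S_step (hids : Function.Injective ids) {i : Fin n}
    (h : ids i ∈ ((step ids G r c).node j).S) :
    (nodeDecision ids G c j).Sbr ∧ G.Adj i j ∨
      ids i ∈ (c.node j).S ∧ statePair c j = newPair ids G c j := by
  classical
  rw [S_step, (decision_S_sbr ids G c j).1] at h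
  rw [(decision_S_sbr ids G c j).2]
  by_cases he : statePair c j = newPair ids G c j
  · rw [if_pos he, Finset.mem_union, mem_nbrIds hids] at h
    by_cases hS : ids i ∈ (c.node j).S
    · exact Or.inr ⟨hS, he⟩
    · have hadj := h.resolve_left hS
      exact Or.inl ⟨Or.inr fun hsub => hS (hsub ((mem_nbrIds hids).2 hadj)), hadj.symm⟩
  · rw [if_neg he, mem_nbrIds hids] at h
    exact Or.inl ⟨Or.inl he, h.symm⟩

theorem mem_S_step_of_adj (hids : Function.Injective ids) {i : Fin n} (h : G.Adj j i) :
    ids i ∈ ((step ids G r c).node j).S := by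
  classical
  rw [S_step, (decision_S_sbr ids G c j).1]
  have := (mem_nbrIds (j := j) hids).2 h
  split_ifs
  · exact Finset.mem_union_right _ this
  · exact this

theorem S_subset_S_step (h : statePair c j = newPair ids G c j) :
    (c.node j).S ⊆ ((step ids G r c).node j).S := by
  classical
  rw [S_step, (decision_S_sbr ids G c j).1, if_pos h]
  exact Finset.subset_union_left

end Config

section Deterministic

variable {n : ℕ} {ID : Type*} {ids : Fin n → ID} {tot : ℤ × ℕ}

/-! ### Invariants of the algorithm -/

/-- Invariants of every reachable configuration, where `tot` is the total mass. -/
structure Inv (ids : Fin n → ID) (tot : ℤ × ℕ) (c : Config n ID) : Prop where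
  informed : ∀ i j, ids i ∈ (c.node j).S → key (statePair c j) ≤ pendingKey c i
  contacted : ∀ i j, ids i ∈ (c.node j).S → Settled c i ∨ (c.inbox i).Received
  bounded : ∀ i, ∃ j, pendingKey c i ≤ key (mass c j)
  conserved : ∑ j, mass c j = tot
  isMass : ∀ j, IsMass (mass c j)
  zs_pos : ∀ j, 0 < (statePair c j).2

theorem sum_mass_step {G : SimpleGraph (Fin n)} {r : Fin n → Fin n} {c : Config n ID} :
    ∑ j, mass (step ids G r c) j = ∑ j, mass c j := by
  simp only [mass_step]
  rw [Finset.sum_comm]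
  simp

theorem isMass_step {G : SimpleGraph (Fin n)} {r : Fin n → Fin n} {c : Config n ID}
    (h : ∀ j, IsMass (mass c j)) (j : Fin n) : IsMass (mass (step ids G r c) j) := by
  rw [mass_step]
  refine IsMass.sum fun i _ => ?_
  split_ifs
  · exact h i
  · exact Or.inl rfl

/-- All masses are nonnegative, so merging can only enlarge them. This keeps the greatest mass from
decreasing. -/
theorem mass_le_mass_step {G : SimpleGraph (Fin n)} {r : Fin n → Fin n} {c : Config n ID}
    (h : ∀ j, IsMass (mass c j)) (i : Fin n) :
    mass c i ≤ mass (step ids G r c) (dest ids G c r i) := by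
  classical
  rw [mass_step]
  have := Finset.single_le_sum
    (f := fun x => if dest ids G c r x = dest ids G c r i then mass c x else 0)
    (s := Finset.univ) (fun x _ => by
      split_ifs
      · exact (h x).nonneg
      · exact le_rfl) (Finset.mem_univ i)
  simpa using this

theorem Inv.step (hids : Function.Injective ids) {c : Config n ID} (h : Inv ids tot c)
    (G : SimpleGraph (Fin n)) (r : Fin n → Fin n) : Inv ids tot (step ids G r c) where
  informed i j hij := by
    rcases sent_of_mem_S_step r hids hij with h1 | ⟨h1, h2⟩
    · exact le_pendingKey_step r h1.1 h1.2
    -- The state of `j` is unchanged, and `i` has by now absorbed everything that was pending.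
    · rw [statePair_step, ← h2]
      exact ((h.informed i j h1).trans (pendingKey_le_newKey ids G c i)).trans
        (stateKey_le_pendingKey (DataAlloc.step ids G r c) i)
  contacted i j hij := by
    rcases sent_of_mem_S_step r hids hij with h1 | ⟨h1, h2⟩
    · exact Or.inr (received_step r h1.1 h1.2)
    · exact Or.inl (settled_step r (h.contacted i j h1) (h.zs_pos i))
  bounded i := by
    have : Nonempty (Fin n) := ⟨i⟩
    obtain ⟨m, hm⟩ := Finite.exists_max fun j => key (mass (DataAlloc.step ids G r c) j)
    have hmass : ∀ j, key (mass c j) ≤ key (mass (DataAlloc.step ids G r c) m) := fun j =>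
      (key_mono (mass_le_mass_step h.isMass j)).trans (hm _)
    refine ⟨m, pendingKey_step_le r fun j => ?_⟩
    obtain ⟨j', hj'⟩ := h.bounded j
    have hpend := hj'.trans (hmass j')
    by_cases hr : (c.inbox j).Received
    · rw [key_newPair_of_received _ _ _ _ hr]
      exact max_le hpend (hmass j)
    · rw [newPair_of_not_received _ _ _ _ hr]
      exact (stateKey_le_pendingKey c j).trans hpend
  conserved := sum_mass_step.trans h.conserved
  isMass := isMass_step h.isMass
  zs_pos j := (h.zs_pos j).trans_le (snd_le_of_key_le (stateKey_le_newKey ids G c j))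

theorem inv_initConfig (hids : Function.Injective ids) (G0 : SimpleGraph (Fin n))
    (L δ ν : Fin n → ℕ) (hpos : ∀ j, 0 < L j + δ j) (hν : ∀ j, 0 < ν j) :
    Inv ids (∑ j, (ν j : ℤ), ∑ j, (L j + δ j)) (initConfig ids G0 L δ ν) := by
  classical
  have hmass : ∀ j, mass (initConfig ids G0 L δ ν) j = ((ν j : ℤ), L j + δ j) := by
    intro j
    simp [mass, initConfig]
  have hmsg : ∀ i j, ((initConfig ids G0 L δ ν).inbox i).stateMsg j =
      if G0.Adj i j then some ((ν j : ℤ), 1) else none := by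
    intro i j
    have h : j ∈ nbrs G0 i ↔ G0.Adj i j := by simp [nbrs]
    by_cases h1 : G0.Adj i j <;> simp [initConfig, h, h1]
  have hstate : ∀ j, statePair (initConfig ids G0 L δ ν) j = ((ν j : ℤ), 1) := fun j => rfl
  have hsent : ∀ i j, ids i ∈ ((initConfig ids G0 L δ ν).node j).S → G0.Adj i j := by
    intro i j h
    exact ((mem_nbrIds hids).1 h).symm
  refine ⟨fun i j hij => ?_, fun i j hij => ?_, fun i => ?_, ?_, fun j => ?_, fun j => ?_⟩
  · have := key_getD_le_maxReceived ((initConfig ids G0 L δ ν).inbox i)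
      (statePair (initConfig ids G0 L δ ν) i) j
    rwa [hmsg, if_pos (hsent i j hij)] at this
  · exact Or.inr (Or.inr ⟨j, by rw [hmsg, if_pos (hsent i j hij)]; rfl⟩)
  · have : Nonempty (Fin n) := ⟨i⟩
    obtain ⟨m, hm⟩ := Finite.exists_max fun j => key (mass (initConfig ids G0 L δ ν) j)
    -- The initial state `(ν j, 1)` is at most the initial mass of `j` because `L j + δ j ≥ 1`.
    have hle : ∀ j, key ((ν j : ℤ), 1) ≤ key (mass (initConfig ids G0 L δ ν) m) := fun j => by
      refine le_trans ?_ (hm j)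
      rw [hmass]
      exact key_mono ⟨le_rfl, hpos j⟩
    refine ⟨m, maxReceived_le (hle i) fun j => ?_⟩
    rw [hmsg]
    split_ifs
    · exact hle j
    · exact hle i
  · simp only [hmass]
    rw [Prod.ext_iff]
    simp [Prod.fst_sum, Prod.snd_sum]
  · rw [hmass]
    exact Or.inr ⟨Int.natCast_pos.2 (hν j), hpos j⟩
  · exact one_pos

/-- The invariants hold and every node has processed a message. -/
def Regular (ids : Fin n → ID) (tot : ℤ × ℕ) (c : Config n ID) : Prop :=
  Inv ids tot c ∧ ∀ j, Settled c j

theorem Regular.step (hids : Function.Injective ids) {c : Config n ID} (h : Regular ids tot c)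
    (G : SimpleGraph (Fin n)) (r : Fin n → Fin n) : Regular ids tot (step ids G r c) :=
  ⟨h.1.step hids G r, fun j => settled_step r (Or.inl (h.2 j)) (h.1.zs_pos j)⟩

theorem Regular.stateKey_le {c : Config n ID} (h : Regular ids tot c) {m : Fin n}
    (hm : ∀ i, key (mass c i) ≤ key (mass c m)) (i : Fin n) :
    key (statePair c i) ≤ key (mass c m) := by
  obtain ⟨j, hj⟩ := h.1.bounded i
  exact (stateKey_le_pendingKey c i).trans (hj.trans (hm j))

/-! ### Synchronized configurations -/

/-- All state variables equal the mass of node `m`, which is the greatest one. -/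
def Synced (c : Config n ID) (m : Fin n) : Prop :=
  (∀ i, statePair c i = mass c m) ∧ ∀ i, key (mass c i) ≤ key (mass c m)

/-- States never decrease and cannot exceed the greatest mass, which they already equal. -/
theorem Synced.newPair_eq {c : Config n ID} {m : Fin n} (hs : Synced c m)
    (h : Regular ids tot c) (G : SimpleGraph (Fin n)) (i : Fin n) :
    newPair ids G c i = mass c m := by
  apply key_injective
  refine le_antisymm ?_ ?_
  · rw [(h.2 i).key_newPair]
    obtain ⟨j, hj⟩ := h.1.bounded i
    exact max_le (hj.trans (hs.2 j)) (hs.2 i)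
  · rw [← hs.1 i]
    exact stateKey_le_newKey ids G c i

theorem Synced.mtr_iff {c : Config n ID} {m : Fin n} (hs : Synced c m)
    (h : Regular ids tot c) (G : SimpleGraph (Fin n)) (i : Fin n) :
    (nodeDecision ids G c i).Mtr ↔ ¬ Proportional (mass c i) (mass c m) := by
  rw [(h.2 i).mtr_iff, hs.newPair_eq h, lagging_iff (h.1.isMass i) _ (hs.2 i)]
  rw [← hs.1 i]
  exact h.1.zs_pos i

theorem Synced.step_of_le {c : Config n ID} {m : Fin n} (hs : Synced c m)
    (h : Regular ids tot c) {G : SimpleGraph (Fin n)} {r : Fin n → Fin n}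
    (hm : mass (step ids G r c) m = mass c m)
    (hle : ∀ i, key (mass (step ids G r c) i) ≤ key (mass c m)) : Synced (step ids G r c) m := by
  refine ⟨fun i => ?_, fun i => ?_⟩
  · rw [statePair_step, hs.newPair_eq h, hm]
  · rw [hm]
    exact hle i

/-! ### Iterations in which every node addresses itself -/

theorem mass_step_id {G : SimpleGraph (Fin n)} {c : Config n ID} :
    mass (step ids G id c) = mass c := by
  funext j
  rw [mass_step]
  simp [dest]

variable {G : ℕ → SimpleGraph (Fin n)}

/-- The configuration after `d` iterations from iteration `k` on, in which every node addresses
itself. -/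
noncomputable def idle (ids : Fin n → ID) (G : ℕ → SimpleGraph (Fin n)) (k : ℕ)
    (c : Config n ID) : ℕ → Config n ID
  | 0 => c
  | d + 1 => step ids (G (k + d)) id (idle ids G k c d)

theorem mass_idle {k : ℕ} {c : Config n ID} (d : ℕ) : mass (idle ids G k c d) = mass c := by
  induction d with
  | zero => rfl
  | succ d ih => rw [idle, mass_step_id, ih]

theorem Regular.idle (hids : Function.Injective ids) {k : ℕ} {c : Config n ID}
    (h : Regular ids tot c) (d : ℕ) : Regular ids tot (idle ids G k c d) := by
  induction d with
  | zero => exact h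
  | succ d ih => exact ih.step hids _ _

theorem stateKey_idle_mono {k : ℕ} {c : Config n ID} (i : Fin n) :
    Monotone fun d => key (statePair (idle ids G k c d) i) :=
  monotone_nat_of_le_succ fun d => stateKey_le_newKey ids (G (k + d)) (idle ids G k c d) i

theorem Synced.idle (hids : Function.Injective ids) {k : ℕ} {c : Config n ID} {m : Fin n}
    (hs : Synced c m) (h : Regular ids tot c) (d : ℕ) : Synced (idle ids G k c d) m := by
  induction d with
  | zero => exact hs
  | succ d ih =>
    refine ih.step_of_le (h.idle hids d) ?_ fun i => ?_
    · rw [mass_step_id]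
    · rw [mass_step_id]
      exact ih.2 i

/-- `Reach ids G k c k' c'`: the configuration `c` at the beginning of iteration `k` can evolve to
`c'` at the beginning of iteration `k'`. -/
inductive Reach (ids : Fin n → ID) (G : ℕ → SimpleGraph (Fin n)) (k : ℕ) (c : Config n ID) :
    ℕ → Config n ID → Prop
  | refl : Reach ids G k c k c
  | tail {k' : ℕ} {c' : Config n ID} (h : Reach ids G k c k' c') (r : Fin n → Fin n)
      (hr : ∀ j, r j = j ∨ (G k').Adj j (r j)) :
      Reach ids G k c (k' + 1) (DataAlloc.step ids (G k') r c')

theorem Reach.trans {k₁ k₂ k₃ : ℕ} {c₁ c₂ c₃ : Config n ID} (h₁ : Reach ids G k₁ c₁ k₂ c₂)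
    (h₂ : Reach ids G k₂ c₂ k₃ c₃) : Reach ids G k₁ c₁ k₃ c₃ := by
  induction h₂ with
  | refl => exact h₁
  | tail _ r hr ih => exact ih.tail r hr

theorem reach_idle (k : ℕ) (c : Config n ID) (d : ℕ) :
    Reach ids G k c (k + d) (idle ids G k c d) := by
  induction d with
  | zero => exact .refl
  | succ d ih => exact ih.tail id fun j => Or.inl rfl

theorem Reach.regular (hids : Function.Injective ids) {k k' : ℕ} {c c' : Config n ID}
    (h : Reach ids G k c k' c') (hc : Regular ids tot c) : Regular ids tot c' := by
  induction h with
  | refl => exact hc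
  | tail _ r _ ih => exact ih.step hids _ r

variable {Gnom : SimpleGraph (Fin n)} {W : ℕ}

/-- In every window of `W` iterations every edge of `Gnom` appears. -/
def EdgesRecur (G : ℕ → SimpleGraph (Fin n)) (Gnom : SimpleGraph (Fin n)) (W : ℕ) : Prop :=
  ∀ k i j, Gnom.Adj i j → ∃ d, d < W ∧ (G (k + d)).Adj i j

/-! ### Spreading of the greatest mass -/

/-- The edge appears after `d < W` iterations. From then on `S` of node `i` contains `j`, so the
invariant `informed` applies whether the state is sent now or was sent earlier. One more iteration
lets `j` adopt it. -/
theorem le_stateKey_idle_of_adj (hids : Function.Injective ids) (hE : EdgesRecur G Gnom W)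
    {k D : ℕ} {c : Config n ID} (hc : Regular ids tot c) {B : ℕ ×ₗ ℤ} {i j : Fin n}
    (hij : Gnom.Adj i j) (hi : B ≤ key (statePair (idle ids G k c D) i)) :
    B ≤ key (statePair (idle ids G k c (D + (W + 1))) j) := by
  obtain ⟨d, hd, hadj⟩ := hE (k + D) i j hij
  rw [add_assoc] at hadj
  have hmem : ids j ∈ ((idle ids G k c (D + d + 1)).node i).S :=
    mem_S_step_of_adj (c := idle ids G k c (D + d)) id hids hadj
  have hinf := (hc.idle hids (D + d + 1)).1.informed j i hmem
  calc B ≤ key (statePair (idle ids G k c D) i) := hi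
    _ ≤ key (statePair (idle ids G k c (D + d + 1)) i) := stateKey_idle_mono i (by omega)
    _ ≤ pendingKey (idle ids G k c (D + d + 1)) j := hinf
    _ ≤ key (statePair (idle ids G k c (D + d + 1 + 1)) j) := pendingKey_le_newKey ids _ _ j
    _ ≤ _ := stateKey_idle_mono j (by omega)

theorem le_stateKey_idle_of_walk (hids : Function.Injective ids) (hE : EdgesRecur G Gnom W)
    {k : ℕ} {c : Config n ID} (hc : Regular ids tot c) {B : ℕ ×ₗ ℤ} {i j : Fin n}
    (w : Gnom.Walk i j) : ∀ {D : ℕ}, B ≤ key (statePair (idle ids G k c D) i) →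
      B ≤ key (statePair (idle ids G k c (D + w.length * (W + 1))) j) := by
  induction w with
  | nil => intro D hD; simpa using hD
  | cons hadj w ih =>
    intro D hD
    have := ih (le_stateKey_idle_of_adj hids hE hc hadj hD)
    rw [SimpleGraph.Walk.length_cons, Nat.succ_mul, add_comm (_ * _), ← add_assoc]
    exact this

theorem exists_walk_length_le (hconn : Gnom.Connected) (i j : Fin n) :
    ∃ w : Gnom.Walk i j, w.length ≤ n := by
  obtain ⟨w, hw⟩ := (hconn.preconnected i j).exists_isPath
  exact ⟨w, by simpa using hw.length_lt.le⟩

/-- One iteration turns the greatest mass into the state of its holder, and walks of length at most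
`n` carry it to all nodes. The invariant `bounded` gives the opposite inequality. -/
theorem exists_synced (hids : Function.Injective ids) (hE : EdgesRecur G Gnom W)
    (hconn : Gnom.Connected) {k : ℕ} {c : Config n ID} (hc : Regular ids tot c) :
    ∃ m, Synced (idle ids G k c (1 + n * (W + 1))) m := by
  have := hconn.nonempty
  obtain ⟨m, hm⟩ := Finite.exists_max fun j => key (mass c j)
  have h1 : key (mass c m) ≤ key (statePair (idle ids G k c 1) m) := by
    have : key (newPair ids (G (k + 0)) c m) = max (pendingKey c m) (key (mass c m)) :=
      (hc.2 m).key_newPair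
    exact (le_max_right _ _).trans this.ge
  have hR := hc.idle (G := G) (k := k) hids (1 + n * (W + 1))
  have hm' : ∀ i, key (mass (idle ids G k c (1 + n * (W + 1))) i) ≤
      key (mass (idle ids G k c (1 + n * (W + 1))) m) := by
    rw [mass_idle]
    exact hm
  refine ⟨m, fun i => key_injective (le_antisymm (hR.stateKey_le hm' i) ?_), hm'⟩
  obtain ⟨w, hw⟩ := exists_walk_length_le hconn m i
  rw [mass_idle]
  refine (le_stateKey_idle_of_walk hids hE hc w h1).trans (stateKey_idle_mono i ?_)
  gcongr

/-! ### Merging of masses -/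

/-- The number of nodes with a nonzero mass. -/
noncomputable def numMass (c : Config n ID) : ℕ :=
  open Classical in (Finset.univ.filter fun i => mass c i ≠ 0).card

theorem sum_update_id {M : Type*} [AddCommMonoid M] (f : Fin n → M) {i i' : Fin n} (h : i ≠ i')
    (j : Fin n) : (∑ x, if Function.update id i i' x = j then f x else 0) =
      if j = i then 0 else if j = i' then f i + f i' else f j := by
  split_ifs with h1 h2
  · subst h1
    refine Finset.sum_eq_zero fun x _ => if_neg ?_
    rcases eq_or_ne x j with rfl | hx
    · simpa using h.symm
    · simp [hx]
  · subst h2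
    rw [Fintype.sum_eq_add i j h]
    · simp [h.symm]
    · rintro x ⟨hx, hx'⟩
      simp [hx, hx']
  · rw [Fintype.sum_eq_single j]
    · simp [h1]
    · intro x hx
      rcases eq_or_ne x i with rfl | hx'
      · simp [Ne.symm h2]
      · simp [hx, hx']

/-- Induction on the walk: wait for its first edge and send the mass across. Either the next node
holds a nonzero mass and the two merge, or the mass has only moved and a shorter walk remains. Node
`m` has nonzero mass, so a merge must occur. -/
theorem exists_merge (hids : Function.Injective ids) (hE : EdgesRecur G Gnom W)
    {i m : Fin n} (w : Gnom.Walk i m) : ∀ {k : ℕ} {c : Config n ID}, Regular ids tot c →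
      Synced c m → ¬ Proportional (mass c i) (mass c m) →
      ∃ k' c', k' ≤ k + w.length * W ∧ Reach ids G k c k' c' ∧ numMass c' < numMass c := by
  classical
  induction w with
  | nil => intro k c _ _ h; exact absurd rfl h
  | @cons i i' m hadj w ih =>
    intro k c hc hs hprop
    obtain ⟨d, hd, hG⟩ := hE k i i' hadj
    have hc1 := hc.idle (G := G) (k := k) hids d
    have hs1 := hs.idle (G := G) (k := k) hids hc d
    have hreach := reach_idle (ids := ids) (G := G) k c d
    have hmass : mass (idle ids G k c d) = mass c := mass_idle d
    rw [← hmass] at hprop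
    have hnum : numMass (idle ids G k c d) = numMass c := by rw [numMass, hmass, numMass]
    rw [← hnum]
    generalize idle ids G k c d = c₁ at *
    have hne : i ≠ i' := hG.ne
    -- Only `i` addresses another node. Others may transmit too, but to themselves, which leaves
    -- their masses in place.
    have hreach2 := hreach.tail (Function.update id i i') fun j => by
      rcases eq_or_ne j i with rfl | hj
      · right; simpa using hG
      · left; simp [hj]
    have hdest : ∀ x, dest ids (G (k + d)) c₁ (Function.update id i i') x
        = Function.update id i i' x := by
      intro x
      unfold dest
      split_ifs with hx
      · rfl
      · rcases eq_or_ne x i with rfl | hxi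
        · exact absurd ((hs1.mtr_iff hc1 _ x).2 hprop) hx
        · simp [hxi]
    have hstep : ∀ j, mass (step ids (G (k + d)) (Function.update id i i') c₁) j =
        if j = i then 0 else if j = i' then mass c₁ i + mass c₁ i' else mass c₁ j := by
      intro j
      rw [mass_step]
      simp only [hdest]
      exact sum_update_id _ hne j
    have hc2 := hc1.step hids (G (k + d)) (Function.update id i i')
    have hi0 : mass c₁ i ≠ 0 := by
      intro h0
      apply hprop
      simp [h0, Proportional]
    by_cases hi' : mass c₁ i' = 0
    -- The node `i'` is empty, hence differs from `m`. The greatest mass stays at `m` and the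
    -- configuration stays synchronized.
    · have hm0 : 0 < (mass c₁ m).2 := hs1.1 i ▸ hc1.1.zs_pos i
      have hmi : m ≠ i := by
        rintro rfl
        exact hprop rfl
      have hmi' : m ≠ i' := by
        rintro rfl
        simp [hi'] at hm0
      have hmm : mass (step ids (G (k + d)) (Function.update id i i') c₁) m = mass c₁ m := by
        rw [hstep, if_neg hmi, if_neg hmi']
      have hs2 : Synced (step ids (G (k + d)) (Function.update id i i') c₁) m := by
        refine hs1.step_of_le hc1 hmm fun j => ?_
        rw [hstep]
        split_ifs
        · exact key_le_key.2 (Or.inl hm0)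
        · rw [hi', add_zero]
          exact hs1.2 i
        · exact hs1.2 j
      obtain ⟨k', c', hk', hr', hlt⟩ := ih hc2 hs2 (by
        rwa [hmm, hstep, if_neg hne.symm, if_pos rfl, hi', add_zero])
      refine ⟨k', c', hk'.trans ?_, hreach2.trans hr', hlt.trans_le ?_⟩
      · rw [SimpleGraph.Walk.length_cons, Nat.succ_mul]
        omega
      -- Swapping `i` and `i'` maps the nodes with nonzero mass after the move to those before it.
      · refine Finset.card_le_card_of_injOn (Equiv.swap i i') ?_ (Equiv.injective _).injOn
        intro j hj
        simp only [Finset.coe_filter, Finset.mem_univ, true_and, Set.mem_ofPred_eq, hstep] at hj ⊢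
        split_ifs at hj with h1 h2
        · exact absurd rfl hj
        · rw [h2, Equiv.swap_apply_right]
          exact hi0
        · rwa [Equiv.swap_apply_of_ne_of_ne h1 h2]
    -- The merged mass may exceed the one at `m` and destroy synchrony, but only the smaller count
    -- matters here.
    · refine ⟨k + d + 1, _, ?_, hreach2, Finset.card_lt_card ?_⟩
      · rw [SimpleGraph.Walk.length_cons, Nat.succ_mul]
        omega
      · rw [Finset.ssubset_iff_of_subset]
        · exact ⟨i, by simpa using hi0, by simp [hstep]⟩
        · intro j hj
          simp only [Finset.mem_filter, Finset.mem_univ, true_and, hstep] at hj ⊢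
          split_ifs at hj with h1 h2
          · exact absurd rfl hj
          · rwa [h2]
          · exact hj

/-! ### Terminal configurations -/

/-- All states agree, have the fraction of every mass, and are known to have been sent to all
neighbours in `Gnom`. -/
def Terminal (ids : Fin n → ID) (tot : ℤ × ℕ) (Gnom : SimpleGraph (Fin n)) (c : Config n ID) :
    Prop :=
  Regular ids tot c ∧ ∃ m, Synced c m ∧ (∀ i, Proportional (mass c i) (mass c m)) ∧
    ∀ i j, Gnom.Adj j i → ids i ∈ (c.node j).S

theorem mass_step_of_proportional {c : Config n ID} {m : Fin n} (hs : Synced c m)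
    (h : Regular ids tot c) (hp : ∀ i, Proportional (mass c i) (mass c m))
    (G : SimpleGraph (Fin n)) (r : Fin n → Fin n) : mass (step ids G r c) = mass c := by
  classical
  have hdest : ∀ i, dest ids G c r i = i := fun i =>
    if_neg fun hM => (hs.mtr_iff h G i).1 hM (hp i)
  funext j
  rw [mass_step]
  simp [hdest]

theorem Terminal.step (hids : Function.Injective ids) {c : Config n ID}
    (h : Terminal ids tot Gnom c) (G : SimpleGraph (Fin n)) (r : Fin n → Fin n) :
    Terminal ids tot Gnom (step ids G r c) := by
  obtain ⟨hR, m, hs, hp, hS⟩ := h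
  have hmass := mass_step_of_proportional hs hR hp G r
  refine ⟨hR.step hids G r, m, hs.step_of_le hR (by rw [hmass]) (by rw [hmass]; exact hs.2),
    by rw [hmass]; exact hp, fun i j hij => ?_⟩
  refine S_subset_S_step r ?_ (hS i j hij)
  rw [hs.newPair_eq hR, hs.1]

/-- No new neighbour can trigger a broadcast, because every edge of `G` lies in `Gnom` and its
endpoints are already in each other's `S`. -/
theorem Terminal.silent {c : Config n ID} (h : Terminal ids tot Gnom c)
    {G : SimpleGraph (Fin n)} (hG : G ≤ Gnom) (j : Fin n) :
    ¬ ((nodeDecision ids G c j).Mtr ∨ (nodeDecision ids G c j).Sbr) := by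
  classical
  obtain ⟨hR, m, hs, hp, hS⟩ := h
  rintro (h1 | h1)
  · exact (hs.mtr_iff hR G j).1 h1 (hp j)
  · rw [(decision_S_sbr ids G c j).2] at h1
    rcases h1 with h1 | h1
    · exact h1 (by rw [hs.newPair_eq hR, hs.1])
    · refine h1 fun x hx => ?_
      simp only [nbrIds, nbrs, Finset.mem_image, Finset.mem_filter, Finset.mem_univ,
        true_and] at hx
      obtain ⟨i, hi, rfl⟩ := hx
      exact hS i j (hG hi)

/-- Proportionality to a fixed pair is additive, so it passes from the single masses to their
conserved sum. -/
theorem Terminal.statePair_proportional {c : Config n ID} (h : Terminal ids tot Gnom c)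
    (j : Fin n) : Proportional tot (statePair c j) ∧ 0 < (statePair c j).2 := by
  obtain ⟨hR, m, hs, hp, -⟩ := h
  refine ⟨?_, hR.1.zs_pos j⟩
  rw [hs.1 j, ← hR.1.conserved]
  unfold Proportional at hp ⊢
  rw [Prod.fst_sum, Prod.snd_sum, Finset.sum_mul, Nat.cast_sum, Finset.mul_sum]
  exact Finset.sum_congr rfl fun i _ => hp i

/-- States no longer change, so the sets `S` only grow, and within `W` iterations every edge of
`Gnom` has appeared. -/
theorem terminal_idle_of_proportional (hids : Function.Injective ids)
    (hE : EdgesRecur G Gnom W) {k : ℕ} {c : Config n ID} {m : Fin n} (hc : Regular ids tot c)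
    (hs : Synced c m) (hp : ∀ i, Proportional (mass c i) (mass c m)) :
    Terminal ids tot Gnom (idle ids G k c W) := by
  refine ⟨hc.idle hids W, m, hs.idle hids hc W, by rw [mass_idle]; exact hp, fun i j hij => ?_⟩
  have hmono : Monotone fun d => ((idle ids G k c d).node j).S := by
    refine monotone_nat_of_le_succ fun d => ?_
    refine S_subset_S_step id ?_
    rw [(hs.idle hids hc d).newPair_eq (hc.idle hids d), (hs.idle hids hc d).1]
  obtain ⟨d, hd, hadj⟩ := hE k j i hij
  exact hmono hd (mem_S_step_of_adj (c := idle ids G k c d) id hids hadj)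

/-- Each round synchronizes in `1 + n * (W + 1)` iterations and then merges in at most `n * W`.
There are at most `N` merging rounds; after the last synchronization, `W` iterations fill the sets
`S`. -/
theorem exists_reach_terminal (hids : Function.Injective ids) (hE : EdgesRecur G Gnom W)
    (hconn : Gnom.Connected) (N : ℕ) : ∀ {k : ℕ} {c : Config n ID}, Regular ids tot c →
      numMass c ≤ N → ∃ k' c', k' ≤ k + ((N + 1) * (1 + n * (W + 1) + n * W) + W) ∧
        Reach ids G k c k' c' ∧ Terminal ids tot Gnom c' := by
  induction N using Nat.strong_induction_on with
  | _ N ih =>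
  intro k c hc hN
  obtain ⟨m, hs⟩ := exists_synced (k := k) hids hE hconn hc
  have hreach := reach_idle (ids := ids) (G := G) k c (1 + n * (W + 1))
  have hc1 := hc.idle (G := G) (k := k) hids (1 + n * (W + 1))
  have hnum : numMass (idle ids G k c (1 + n * (W + 1))) ≤ N := by
    rwa [numMass, mass_idle]
  by_cases hp : ∀ i, Proportional (mass (idle ids G k c (1 + n * (W + 1))) i)
      (mass (idle ids G k c (1 + n * (W + 1))) m)
  · refine ⟨_, _, ?_, hreach.trans (reach_idle _ _ W),
      terminal_idle_of_proportional hids hE hc1 hs hp⟩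
    rw [Nat.succ_mul]
    omega
  · push Not at hp
    obtain ⟨i, hi⟩ := hp
    obtain ⟨w, hw⟩ := exists_walk_length_le hconn i m
    obtain ⟨k', c', hk', hr', hlt⟩ := exists_merge (k := k + (1 + n * (W + 1))) hids hE w hc1 hs hi
    have hlt' := hlt.trans_le hnum
    obtain ⟨M, rfl⟩ : ∃ M, N = M + 1 := ⟨N - 1, by omega⟩
    have hr := hreach.trans hr'
    obtain ⟨k'', c'', hk'', hr'', ht⟩ := ih M (Nat.lt_succ_self M) (hr.regular hids hc)
      (Nat.le_of_lt_succ hlt')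
    refine ⟨k'', c'', ?_, hr.trans hr'', ht⟩
    have hww : w.length * W ≤ n * W := Nat.mul_le_mul_right _ hw
    rw [Nat.succ_mul (M + 1)]
    omega

theorem exists_reach_terminal_after (hids : Function.Injective ids) (hE : EdgesRecur G Gnom W)
    (hconn : Gnom.Connected) : ∃ T : ℕ, ∀ (k : ℕ) (c : Config n ID), Regular ids tot c →
      ∃ c', Reach ids G k c (k + T) c' ∧ Terminal ids tot Gnom c' := by
  refine ⟨(n + 1) * (1 + n * (W + 1) + n * W) + W, fun k c hc => ?_⟩
  obtain ⟨k', c', hk', hr, ht⟩ := exists_reach_terminal hids hE hconn n (k := k) hc (by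
    classical
    exact (Finset.card_le_univ _).trans (by simp))
  -- Idling after the terminal time makes the length exactly `T` for every start.
  obtain ⟨d, hd⟩ := Nat.exists_eq_add_of_le hk'
  refine ⟨idle ids G k' c' d, ?_, ?_⟩
  · rw [hd]
    exact hr.trans (reach_idle _ _ d)
  · clear hd
    induction d with
    | zero => exact ht
    | succ d ih => exact ih.step hids _ _

/-! ### The nominal graph -/

theorem HasNominalGraph.exists_window {l : ℕ} (h : HasNominalGraph G Gnom l) :
    ∃ t : ℕ → ℕ, (∀ k, ∃ m, k ≤ t m ∧ t m < k + l) ∧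
      (∀ k, ∃ m, t m ≤ k ∧ k < t (m + 1)) ∧ (∀ m, t (m + 1) < t m + l) ∧
      ∀ m i j, Gnom.Adj i j ↔ ∃ k, t m ≤ k ∧ k < t (m + 1) ∧ (G k).Adj i j := by
  obtain ⟨-, t, h0, ht⟩ := h
  have hmono : StrictMono t := strictMono_nat_of_lt_succ fun m => (ht m).1
  have hgap : ∀ m, t (m + 1) < t m + l := fun m => by have := ht m; omega
  have hl : ∀ k, ∃ m, t m ≤ k ∧ k < t (m + 1) := by
    intro k
    induction k with
    | zero => exact ⟨0, h0.le, by have := (ht 0).1; omega⟩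
    | succ k ih =>
      obtain ⟨m, h1, h2⟩ := ih
      rcases (Nat.succ_le_of_lt h2).lt_or_eq with h3 | h3
      · exact ⟨m, by omega, h3⟩
      · exact ⟨m + 1, h3.ge, by have := (ht (m + 1)).1; omega⟩
  refine ⟨t, fun k => ?_, hl, hgap, fun m i j => ?_⟩
  · rcases k with _ | k
    · exact ⟨0, Nat.zero_le _, by have := hgap 0; have := (ht 0).1; omega⟩
    · obtain ⟨m, h1, h2⟩ := hl k
      exact ⟨m + 1, h2, by have := hgap m; omega⟩
  · rw [← (ht m).2.2]
    simp [unionGraph, and_assoc]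

/-- The first full window starting at or after `k` starts before `k + l` and ends before `k + 2 *
l`. -/
theorem HasNominalGraph.edgesRecur {l : ℕ} (h : HasNominalGraph G Gnom l) :
    EdgesRecur G Gnom (2 * l) := by
  obtain ⟨t, h1, -, h3, h4⟩ := h.exists_window
  intro k i j hij
  obtain ⟨m, hm1, hm2⟩ := h1 k
  obtain ⟨k', hk1, hk2, hadj⟩ := (h4 m i j).1 hij
  obtain ⟨d, rfl⟩ := Nat.exists_eq_add_of_le (hm1.trans hk1)
  exact ⟨d, by have := h3 m; omega, hadj⟩

theorem HasNominalGraph.le_nominal {l : ℕ} (h : HasNominalGraph G Gnom l) (k : ℕ) :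
    G k ≤ Gnom := by
  obtain ⟨t, -, h2, -, h4⟩ := h.exists_window
  obtain ⟨m, hm1, hm2⟩ := h2 k
  exact fun i j hij => (h4 m i j).2 ⟨k, hm1, hm2, hij⟩

/-! ### Runs -/

variable {L δ ν : Fin n → ℕ} {ω : Choices n}

theorem inv_run (hids : Function.Injective ids) (hpos : ∀ j, 0 < L j + δ j) (hν : ∀ j, 0 < ν j)
    (k : ℕ) : Inv ids (∑ j, (ν j : ℤ), ∑ j, (L j + δ j)) (run ids G L δ ν ω k) := by
  induction k with
  | zero => exact inv_initConfig hids _ _ _ _ hpos hν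
  | succ k ih => exact ih.step hids _ _

theorem settled_run_of_le (hids : Function.Injective ids) (hpos : ∀ j, 0 < L j + δ j)
    (hν : ∀ j, 0 < ν j) {j : Fin n} {k k' : ℕ} (hk : k ≤ k')
    (h : Settled (run ids G L δ ν ω k) j) : Settled (run ids G L δ ν ω k') j := by
  induction k', hk using Nat.le_induction with
  | base => exact h
  | succ k' _ ih => exact settled_step _ (Or.inl ih) ((inv_run hids hpos hν k').zs_pos j)

/-- Some neighbour of `j` in `Gnom` meets `j` at a time `d < W` and then has `j` in its set `S`. By
`contacted`, `j` is settled by time `d + 2 ≤ W + 1`. -/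
theorem regular_run (hids : Function.Injective ids) (hpos : ∀ j, 0 < L j + δ j)
    (hν : ∀ j, 0 < ν j) (hn : 2 ≤ n) (hE : EdgesRecur G Gnom W) (hconn : Gnom.Connected)
    {k : ℕ} (hk : W + 1 ≤ k) :
    Regular ids (∑ j, (ν j : ℤ), ∑ j, (L j + δ j)) (run ids G L δ ν ω k) := by
  refine ⟨inv_run hids hpos hν k, fun j => ?_⟩
  have : Nontrivial (Fin n) := Fin.nontrivial_iff_two_le.2 hn
  obtain ⟨i, hi⟩ := hconn.preconnected.exists_adj_of_nontrivial j
  obtain ⟨d, hd, hadj⟩ := hE 0 i j hi.symm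
  rw [zero_add] at hadj
  have hmem : ids j ∈ ((run ids G L δ ν ω (d + 1)).node i).S :=
    mem_S_step_of_adj (c := run ids G L δ ν ω d) _ hids hadj
  have hinv := inv_run (G := G) (ω := ω) hids hpos hν (d + 1)
  have hset : Settled (run ids G L δ ν ω (d + 1 + 1)) j :=
    settled_step _ (hinv.contacted j i hmem) (hinv.zs_pos j)
  exact settled_run_of_le hids hpos hν (by omega) hset

theorem terminal_run_of_le (hids : Function.Injective ids) {k k' : ℕ} (hk : k ≤ k')
    (h : Terminal ids tot Gnom (run ids G L δ ν ω k)) :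
    Terminal ids tot Gnom (run ids G L δ ν ω k') := by
  induction k', hk using Nat.le_induction with
  | base => exact h
  | succ k' _ ih => exact ih.step hids _ _

theorem run_congr {ω' : Choices n} {k : ℕ} (h : ∀ p : ℕ × Fin n, p.1 < k → ω p = ω' p) :
    run ids G L δ ν ω k = run ids G L δ ν ω' k := by
  induction k with
  | zero => rfl
  | succ k ih =>
    rw [run, run, ih fun p hp => h p (hp.trans (Nat.lt_succ_self k))]
    congr 1
    exact funext fun j => h (k, j) (Nat.lt_succ_self k)

theorem Reach.le {k k' : ℕ} {c c' : Config n ID} (h : Reach ids G k c k' c') : k ≤ k' := by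
  induction h with
  | refl => exact le_rfl
  | tail _ _ _ ih => exact ih.trans (Nat.le_succ _)

/-- The first `k'` iterations ignore choices from time `k'` on, so these can be overwritten step by
step. -/
theorem Reach.exists_choices {k k' : ℕ} {c' : Config n ID}
    (h : Reach ids G k (run ids G L δ ν ω k) k' c') :
    ∃ ω' : Choices n, (∀ p : ℕ × Fin n, p.1 < k → ω' p = ω p) ∧
      (∀ p : ℕ × Fin n, k ≤ p.1 → p.1 < k' → ω' p = p.2 ∨ (G p.1).Adj p.2 (ω' p)) ∧
      run ids G L δ ν ω' k' = c' := by
  induction h with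
  | refl => exact ⟨ω, fun _ _ => rfl, fun p h1 h2 => absurd h1 h2.not_ge, rfl⟩
  | @tail k' c' h r hr ih =>
    obtain ⟨ω', h1, h2, h3⟩ := ih
    have hlt : ∀ p : ℕ × Fin n, p.1 < k' → (if p.1 < k' then ω' p else r p.2) = ω' p :=
      fun p hp => if_pos hp
    refine ⟨fun p => if p.1 < k' then ω' p else r p.2, fun p hp => ?_, fun p hp1 hp2 => ?_, ?_⟩
    · exact (hlt p (hp.trans_le h.le)).trans (h1 p hp)
    · dsimp only
      split_ifs with hp
      · exact h2 p hp1 hp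
      · obtain rfl : k' = p.1 := by omega
        exact hr p.2
    · rw [run, run_congr (ω' := ω') hlt, h3]
      simp

end Deterministic

/-! ### Probability of reaching a terminal configuration -/

section Probability

variable {n : ℕ} {G : ℕ → SimpleGraph (Fin n)}

instance isProbabilityMeasure_choiceMeasure (G : ℕ → SimpleGraph (Fin n)) :
    IsProbabilityMeasure (choiceMeasure G) := by
  unfold choiceMeasure
  infer_instance

theorem choiceMeasure_restrict_preimage (I : Finset (ℕ × Fin n)) (ω : Choices n) :
    choiceMeasure G (I.restrict ⁻¹' {I.restrict ω})
      = ∏ p ∈ I, edgeProb (G p.1) (ω p) p.2 := by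
  have h : (I.restrict ⁻¹' {I.restrict ω} : Set (Choices n))
      = Set.pi I fun p => ({ω p} : Set (Fin n)) := by
    ext ω'
    simp [Set.mem_pi, funext_iff]
  rw [h, choiceMeasure, Measure.infinitePi_pi _ fun _ _ => MeasurableSet.singleton _]
  refine Finset.prod_congr rfl fun p _ => ?_
  rw [PMF.toMeasure_apply_singleton _ _ (MeasurableSet.singleton _)]
  rfl

/-- The set `A` of realizations depends only on the choices with indices in `I`. -/
def DependsOnIndices (I : Finset (ℕ × Fin n)) (A : Set (Choices n)) : Prop :=
  ∀ ω ω' : Choices n, I.restrict ω = I.restrict ω' → ω ∈ A → ω' ∈ A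

theorem DependsOnIndices.eq_preimage {I : Finset (ℕ × Fin n)} {A : Set (Choices n)}
    (h : DependsOnIndices I A) : A = I.restrict ⁻¹' (I.restrict '' A) := by
  refine (Set.subset_preimage_image _ _).antisymm ?_
  rintro ω ⟨ω', h1, h2⟩
  exact h ω' ω h2 h1

theorem measurableSet_restrict_preimage (I : Finset (ℕ × Fin n)) (X : Set (I → Fin n)) :
    MeasurableSet (I.restrict ⁻¹' X : Set (Choices n)) :=
  (Finset.measurable_restrict I) X.toFinite.measurableSet

theorem DependsOnIndices.measurableSet {I : Finset (ℕ × Fin n)} {A : Set (Choices n)}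
    (h : DependsOnIndices I A) : MeasurableSet A := by
  rw [h.eq_preimage]
  exact measurableSet_restrict_preimage I _

/-- If every realization in `A` can be changed outside `I` into one in `B`, using choices of
probability at least `q`, then `B` has conditional probability at least `q ^ #(J \ I)`
given `A`. -/
theorem pow_mul_measure_le_measure_inter {I J : Finset (ℕ × Fin n)} (hIJ : I ⊆ J)
    {A B : Set (Choices n)} (hA : DependsOnIndices I A) (hB : DependsOnIndices J B) {q : ℝ≥0∞}
    (h : ∀ ω ∈ A, ∃ ω' ∈ B, I.restrict ω' = I.restrict ω ∧
      ∀ p ∈ J \ I, q ≤ edgeProb (G p.1) (ω' p) p.2) :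
    q ^ (J \ I).card * choiceMeasure G A ≤ choiceMeasure G (A ∩ B) := by
  classical
  -- `A` is a finite disjoint union of cylinders over `I`, so the inequality can be checked on each
  -- cylinder.
  set X : Finset (I → Fin n) := (I.restrict '' A).toFinite.toFinset with hX
  have hAX : A = I.restrict ⁻¹' (X : Set (I → Fin n)) := by
    rw [hX, Set.Finite.coe_toFinset]
    exact hA.eq_preimage
  have hmeas : ∀ x ∈ X, MeasurableSet (I.restrict ⁻¹' {x} : Set (Choices n)) := fun x _ =>
    measurableSet_restrict_preimage I _
  have h1 := sum_measure_preimage_singleton (μ := choiceMeasure G) X hmeas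
  have h2 := sum_measure_preimage_singleton (μ := (choiceMeasure G).restrict B) X hmeas
  rw [← hAX] at h1 h2
  rw [Measure.restrict_apply hA.measurableSet] at h2
  rw [← h1, ← h2, Finset.mul_sum]
  refine Finset.sum_le_sum fun x hx => ?_
  rw [Measure.restrict_apply (hmeas x hx)]
  obtain ⟨ω, hω, rfl⟩ : ∃ ω ∈ A, I.restrict ω = x := by simpa [hX] using hx
  obtain ⟨ω', hB', hI, hq⟩ := h ω hω
  rw [← hI, choiceMeasure_restrict_preimage]
  calc q ^ (J \ I).card * ∏ p ∈ I, edgeProb (G p.1) (ω' p) p.2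
      ≤ (∏ p ∈ J \ I, edgeProb (G p.1) (ω' p) p.2) * ∏ p ∈ I, edgeProb (G p.1) (ω' p) p.2 := by
        gcongr
        exact Finset.pow_card_le_prod _ _ _ hq
    _ = choiceMeasure G (J.restrict ⁻¹' {J.restrict ω'}) := by
        rw [Finset.prod_sdiff hIJ, choiceMeasure_restrict_preimage]
    -- The cylinder of `ω'` over `J` lies in its cylinder over `I`, and in `B` because `B` depends
    -- only on `J`.
    _ ≤ _ := by
        refine measure_mono fun ω'' h'' => ⟨?_, hB ω' ω'' (Eq.symm h'') hB'⟩
        funext p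
        exact congrFun (show J.restrict ω'' = J.restrict ω' from h'') ⟨p, hIJ p.2⟩

theorem inv_le_edgeProb {G : SimpleGraph (Fin n)} {i j : Fin n} (h : i = j ∨ G.Adj j i) :
    (n : ℝ≥0∞)⁻¹ ≤ edgeProb G i j := by
  classical
  have hmem : i = j ∨ i ∈ nbrs G j := by simpa [nbrs] using h
  rw [edgeProb, if_pos hmem, ENNReal.inv_le_inv]
  have hj : j ∉ nbrs G j := by simp [nbrs]
  have := Finset.card_le_univ (insert j (nbrs G j))
  rw [Finset.card_insert_of_notMem hj, Fintype.card_fin] at this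
  exact_mod_cast this

/-- The indices of the choices made before iteration `k`. -/
def indicesBefore (n k : ℕ) : Finset (ℕ × Fin n) := Finset.range k ×ˢ Finset.univ

theorem restrict_indicesBefore_eq_iff {k : ℕ} {ω ω' : Choices n} :
    (indicesBefore n k).restrict ω = (indicesBefore n k).restrict ω' ↔
      ∀ p : ℕ × Fin n, p.1 < k → ω p = ω' p := by
  simp [funext_iff, indicesBefore]

variable {ID : Type*} {ids : Fin n → ID} {Gnom : SimpleGraph (Fin n)} {W : ℕ} {L δ ν : Fin n → ℕ}

theorem dependsOnIndices_run (P : Config n ID → Prop) (k : ℕ) :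
    DependsOnIndices (indicesBefore n k) {ω | P (run ids G L δ ν ω k)} := by
  intro ω ω' h hω
  rw [restrict_indicesBefore_eq_iff] at h
  rw [Set.mem_ofPred_eq] at hω ⊢
  rwa [← run_congr h]

/-- From time `W + 1` on every configuration is regular, so any past can be continued to a terminal
configuration by `T * n` choices of probability at least `1 / n` each. -/
theorem exists_contraction (hids : Function.Injective ids) (hpos : ∀ j, 0 < L j + δ j)
    (hν : ∀ j, 0 < ν j) (hn : 2 ≤ n) (hE : EdgesRecur G Gnom W) (hconn : Gnom.Connected) :
    ∃ T : ℕ, ∃ ρ : ℝ, 0 ≤ ρ ∧ ρ < 1 ∧ ∀ k, W + 1 ≤ k →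
      (choiceMeasure G).real {ω | ¬ Terminal ids (∑ j, (ν j : ℤ), ∑ j, (L j + δ j)) Gnom
        (run ids G L δ ν ω (k + T))} ≤
      ρ * (choiceMeasure G).real {ω | ¬ Terminal ids (∑ j, (ν j : ℤ), ∑ j, (L j + δ j)) Gnom
        (run ids G L δ ν ω k)} := by
  obtain ⟨T, hT⟩ := exists_reach_terminal_after
    (tot := (∑ j, (ν j : ℤ), ∑ j, (L j + δ j))) hids hE hconn
  have hn' : (1 : ℝ) ≤ n := by exact_mod_cast (by omega : 1 ≤ n)
  refine ⟨T, 1 - ((n : ℝ)⁻¹) ^ (T * n), ?_, ?_, fun k hk => ?_⟩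
  · rw [sub_nonneg]
    exact pow_le_one₀ (by positivity) (inv_le_one_of_one_le₀ hn')
  · have : 0 < ((n : ℝ)⁻¹) ^ (T * n) := by positivity
    linarith
  set A : ℕ → Set (Choices n) := fun k => {ω | ¬ Terminal ids
    (∑ j, (ν j : ℤ), ∑ j, (L j + δ j)) Gnom (run ids G L δ ν ω k)} with hAdef
  set B : Set (Choices n) := {ω | Terminal ids
    (∑ j, (ν j : ℤ), ∑ j, (L j + δ j)) Gnom (run ids G L δ ν ω (k + T))} with hBdef
  have hA : DependsOnIndices (indicesBefore n k) (A k) := dependsOnIndices_run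
    (fun c => ¬ Terminal ids (∑ j, (ν j : ℤ), ∑ j, (L j + δ j)) Gnom c) k
  have hB : DependsOnIndices (indicesBefore n (k + T)) B := dependsOnIndices_run _ (k + T)
  have hsub : indicesBefore n k ⊆ indicesBefore n (k + T) :=
    Finset.product_subset_product (Finset.range_mono (Nat.le_add_right k T)) le_rfl
  have hcard : (indicesBefore n (k + T) \ indicesBefore n k).card = T * n := by
    rw [Finset.card_sdiff_of_subset hsub, indicesBefore, indicesBefore, Finset.card_product,
      Finset.card_product, ← Nat.sub_mul]
    simp
  have hlow := pow_mul_measure_le_measure_inter (G := G) (q := (n : ℝ≥0∞)⁻¹) hsub hA hB (by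
    intro ω _
    obtain ⟨c', hr, ht⟩ := hT k (run ids G L δ ν ω k) (regular_run hids hpos hν hn hE hconn hk)
    obtain ⟨ω', h1, h2, rfl⟩ := hr.exists_choices
    refine ⟨ω', ht, restrict_indicesBefore_eq_iff.2 h1, fun p hp => inv_le_edgeProb ?_⟩
    simp only [indicesBefore, Finset.mem_sdiff, Finset.mem_product, Finset.mem_range,
      Finset.mem_univ, and_true, not_lt] at hp
    exact h2 p hp.2 hp.1)
  -- Terminal configurations are absorbing, so failure at `k + T` implies failure at `k`.
  have hdiff : A k \ B = A (k + T) := by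
    ext ω
    refine ⟨fun h => h.2, fun h => ⟨fun h' => h ?_, h⟩⟩
    exact terminal_run_of_le hids (Nat.le_add_right k T) h'
  have hsum := measureReal_inter_add_sdiff (μ := choiceMeasure G) (s := A k) hB.measurableSet
  rw [hdiff] at hsum
  have hlow' := ENNReal.toReal_mono (measure_ne_top _ _) hlow
  rw [hcard, ENNReal.toReal_mul, ENNReal.toReal_pow, ENNReal.toReal_inv,
    ENNReal.toReal_natCast] at hlow'
  change _ * (choiceMeasure G).real (A k) ≤ (choiceMeasure G).real (A k ∩ B) at hlow'
  change (choiceMeasure G).real (A (k + T)) ≤ _ * (choiceMeasure G).real (A k)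
  linarith

theorem exists_terminal_probability (hids : Function.Injective ids)
    (hpos : ∀ j, 0 < L j + δ j) (hν : ∀ j, 0 < ν j) (hn : 2 ≤ n) (hE : EdgesRecur G Gnom W)
    (hconn : Gnom.Connected) {p : ℝ} (hp1 : p < 1) :
    ∃ K : ℕ, ENNReal.ofReal p ≤ choiceMeasure G {ω | Terminal ids
      (∑ j, (ν j : ℤ), ∑ j, (L j + δ j)) Gnom (run ids G L δ ν ω K)} := by
  obtain ⟨T, ρ, hρ0, hρ1, hcontr⟩ := exists_contraction hids hpos hν hn hE hconn
  have hpow : ∀ m : ℕ, (choiceMeasure G).real {ω | ¬ Terminal ids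
      (∑ j, (ν j : ℤ), ∑ j, (L j + δ j)) Gnom (run ids G L δ ν ω (W + 1 + m * T))} ≤ ρ ^ m := by
    intro m
    induction m with
    | zero => simp
    | succ m ih =>
      have := hcontr (W + 1 + m * T) (Nat.le_add_right _ _)
      rw [Nat.succ_mul, ← add_assoc, pow_succ']
      exact this.trans (mul_le_mul_of_nonneg_left ih hρ0)
  obtain ⟨m, hm⟩ := exists_pow_lt_of_lt_one (sub_pos.2 hp1) hρ1
  refine ⟨W + 1 + m * T, ?_⟩
  have hle := (hpow m).trans hm.le
  have hmeas := (dependsOnIndices_run (ids := ids) (G := G) (L := L) (δ := δ) (ν := ν)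
    (Terminal ids (∑ j, (ν j : ℤ), ∑ j, (L j + δ j)) Gnom) (W + 1 + m * T)).measurableSet
  have hcompl := probReal_compl_eq_one_sub (μ := choiceMeasure G) hmeas
  rw [Set.compl_ofPred] at hcompl
  rw [hcompl] at hle
  refine ENNReal.ofReal_le_of_le_toReal ?_
  change p ≤ (choiceMeasure G).real _
  linarith

theorem Terminal.output_eq {ω : Choices n} {k : ℕ} (hν : ∀ j, 0 < ν j)
    (h : Terminal ids (∑ j, (ν j : ℤ), ∑ j, (L j + δ j)) Gnom (run ids G L δ ν ω k))
    (j : Fin n) : output ids G L δ ν ω k j = optimalWorkload L δ ν j := by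
  obtain ⟨hprop, hz⟩ := h.statePair_proportional j
  have hY : (0 : ℚ) < ∑ i, (ν i : ℚ) :=
    Finset.sum_pos (fun i _ => by exact_mod_cast hν i) ⟨j, Finset.mem_univ j⟩
  unfold Proportional statePair at hprop
  unfold statePair at hz
  unfold output optimalWorkload NodeState.qs
  generalize (run ids G L δ ν ω k).node j = s at hprop hz
  have hprop' : (∑ i, (ν i : ℚ)) * s.zs = s.ys * (∑ i, (L i : ℚ) + ∑ i, (δ i : ℚ)) := by
    rw [← Finset.sum_add_distrib]
    exact_mod_cast hprop
  have hz' : (0 : ℚ) < s.zs := by exact_mod_cast hz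
  -- The state fraction is a divisor in the output. It is nonzero because the total memory and
  -- `s.zs` are positive.
  have hys : (s.ys : ℚ) ≠ 0 := by
    intro h0
    rw [h0, zero_mul] at hprop'
    exact (mul_pos hY hz').ne' hprop'
  congr 1
  field_simp
  linear_combination (ν j : ℚ) * hprop'

end Probability

end DataAlloc

theorem theorem1 {n : ℕ} (hn : 2 ≤ n)
    -- the dynamic graph, its nominal graph and the window length
    (G : ℕ → SimpleGraph (Fin n)) (Gnom : SimpleGraph (Fin n)) (l : ℕ)
    (hG : DataAlloc.HasNominalGraph G Gnom l)
    -- unique IDs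
    {ID : Type*} (ids : Fin n → ID) (hids : Function.Injective ids)
    -- load, unavailable memory and total memory of each node
    (L δ ν : Fin n → ℕ)
    (hpos : ∀ j, 0 < L j + δ j) (hν : ∀ j, 0 < ν j)
    -- the total demand is at most the total available memory
    (hmem : ∑ j, (L j : ℤ) ≤ ∑ j, ((ν j : ℤ) - (δ j : ℤ)))
    (p : ℝ) (hp0 : 0 < p) (hp1 : p < 1) :
    ∃ K : ℕ,
      ENNReal.ofReal p ≤ DataAlloc.choiceMeasure G
        {ω | ∀ j : Fin n, ∀ k : ℕ, K ≤ k →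
          DataAlloc.output ids G L δ ν ω k j = DataAlloc.optimalWorkload L δ ν j ∧
            ¬ DataAlloc.Transmits ids G L δ ν ω k j} := by
  obtain ⟨K, hK⟩ := DataAlloc.exists_terminal_probability (L := L) (δ := δ) (ν := ν) hids hpos hν
    hn hG.edgesRecur hG.1 hp1
  refine ⟨K, hK.trans (measure_mono fun ω hω j k hk => ?_)⟩
  -- Absorption turns the event at the single time `K` into a statement about all later times.
  have ht := DataAlloc.terminal_run_of_le hids hk hω
  exact ⟨ht.output_eq hν j, ht.silent (hG.le_nominal k) j⟩
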